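/- Let $x>1$ be an integer with $x\equiv 1$ or $5 \pmod 6$. Then $\mathrm{HWP}(6x;6,2x;1,3x-2)$ has a solution: there is a $1$-factor (perfect matching) $F$ of the complete graph $K_{6x}$ such that the edge set of $K_{6x}-F$ can be partitioned into the edge sets of one $C_6$-factor and $3x-2$ $C_{2x}$-factors of $K_{6x}$. Here a $C_m$-factor ($m\ge 3$) of a graph is a spanning subgraph each of whose connected components is a cycle of length $m$. -/

import Mathlib

/-- `G` (a graph on the vertex set `V`, hence spanning) is a `C_m`-factor: every connected
component of `G` is a cycle of length `m`, where `m ≥ 3`. -/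
def IsCycleFactor {V : Type*} (G : SimpleGraph V) (m : ℕ) : Prop :=
  3 ≤ m ∧ ∀ c : G.ConnectedComponent, Nonempty (c.toSimpleGraph ≃g SimpleGraph.cycleGraph m)

/-- `F` is a `1`-factor of the complete graph on `V`: every vertex is incident with exactly one
edge of `F`. -/
def IsOneFactor {V : Type*} (F : SimpleGraph V) : Prop :=
  (⊤ : F.Subgraph).IsPerfectMatching

/-- The graphs `H i` decompose `G`: their edge sets partition the edge set of `G`. -/
def IsDecomposition {V ι : Type*} (H : ι → SimpleGraph V) (G : SimpleGraph V) : Prop :=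
  (Pairwise fun i j => Disjoint (H i).edgeSet (H j).edgeSet) ∧
    ⋃ i, (H i).edgeSet = G.edgeSet

/-- `HWP(v; M, N; α, β)` has a solution: the complete graph `K_v` (if `v` is odd), respectively
`K_v - F` for some `1`-factor `F` (if `v` is even), decomposes into `α` `C_M`-factors and
`β` `C_N`-factors. -/
def HWPHasSolution (v M N α β : ℕ) : Prop :=
  ∃ (F : SimpleGraph (Fin v)) (A : Fin α → SimpleGraph (Fin v)) (B : Fin β → SimpleGraph (Fin v)),
    (Odd v → F = ⊥) ∧ (Even v → IsOneFactor F) ∧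
    (∀ i, IsCycleFactor (A i) M) ∧ (∀ j, IsCycleFactor (B j) N) ∧
    IsDecomposition (Sum.elim A B) ((⊤ : SimpleGraph (Fin v)) \ F)

open Function

/-! Write x = 2n+1 and take `ZMod 6 × ZMod x` as vertex set. Split K_6 on `ZMod 6` into five perfect
matchings: the four of `partner`, and a fifth. The fifth matching, together with the edges inside
fibres, spans three disjoint copies of K_{2x}. The standard one-factorization has 4n+1 colours:
consecutive ones pair into 2n Hamilton cycles (`isAlternating_clique`), and the last one is the
removed 1-factor. Over each other matching the edges are classified by their difference in `ZMod x`.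
Two consecutive differences form a C_{2x}-factor (`isAlternating_shift`), but x is odd, so pairing
leaves a difference over. In matchings 0 and 1 this is the difference 0, and the two leftovers unite
into the C_6-factor (`isAlternating_hexagon`). In matchings 2 and 3, whose union is the hexagon
0,1,2,3,4,5, the differences 0, 1, 2 are kept together. A set T of r residues decides where to swap
the matchings, and the six classes recombine into three C_{2x}-factors (`isAlternating_mixedShift`).
A walk in such a factor winds around the hexagon and closes after 2x steps because 2r ≡ x mod 3. -/

/-! ### Cycle factors from successor maps and from pairs of involutions. -/

/-- The components are the orbits of `s`, and i ↦ s^i v identifies the standard m-cycle with the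
orbit of v. -/
theorem isCycleFactor_of_minimalPeriod {V : Type*} {G : SimpleGraph V} {m : ℕ} (hm : 3 ≤ m)
    (s : V → V) (hs : ∀ v, minimalPeriod s v = m)
    (hG : ∀ u v, G.Adj u v ↔ v = s u ∨ u = s v) : IsCycleFactor G m := by
  refine ⟨hm, fun c => ?_⟩
  obtain ⟨k, rfl⟩ : ∃ k, m = k + 3 := ⟨m - 3, by omega⟩
  induction c using SimpleGraph.ConnectedComponent.ind with | _ v => ?_
  have hper : ∀ w, s^[k + 3] w = w := fun w => by
    have := iterate_minimalPeriod (f := s) (x := w)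
    rwa [hs] at this
  have hmod : ∀ w i, s^[i % (k + 3)] w = s^[i] w := fun w i => by
    have := iterate_mod_minimalPeriod_eq (f := s) (x := w) (n := i)
    rwa [hs] at this
  have hinj : Injective s := fun a b hab => by
    rw [← hper a, ← hper b]
    exact congrArg s^[k + 2] hab
  have hreach : ∀ i, G.Reachable v (s^[i] v) := by
    intro i
    induction i with
    | zero => exact SimpleGraph.Reachable.refl _
    | succ i ih =>
      rw [iterate_succ_apply']
      exact ih.trans (SimpleGraph.Adj.reachable ((hG _ _).2 (Or.inl rfl)))
  let f : Fin (k + 3) → (G.connectedComponentMk v) := fun i =>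
    ⟨s^[i.val] v, SimpleGraph.ConnectedComponent.eq.2 (hreach i.val).symm⟩
  have hf : Bijective f := by
    constructor
    · intro i j hij
      have h := congrArg Subtype.val hij
      exact Fin.ext (iterate_injOn_Iio_minimalPeriod (f := s) (x := v)
        (by simp [hs]) (by simp [hs]) h)
    · rintro ⟨w, hw⟩
      have hw' : G.Reachable v w := (SimpleGraph.ConnectedComponent.eq.1 hw).symm
      obtain ⟨i, hi⟩ : ∃ i, s^[i] v = w := by
        obtain ⟨p⟩ := hw'
        clear hw f hreach
        induction p with
        | nil => exact ⟨0, rfl⟩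
        | cons h p ih =>
          obtain ⟨i, rfl⟩ := ih
          rcases (hG _ _).1 h with h | h
          · subst h
            exact ⟨i + 1, by rw [iterate_succ_apply]⟩
          -- A backward step equals k + 2 forward steps, since `s` has period k + 3.
          · refine ⟨i + (k + 2), ?_⟩
            rw [h, ← iterate_succ_apply, Nat.succ_eq_add_one, add_assoc, iterate_add_apply, hper]
      refine ⟨⟨i % (k + 3), Nat.mod_lt _ (by omega)⟩, Subtype.ext ?_⟩
      simp only [f, hmod, hi]
  have hstep : ∀ i : Fin (k + 3), (f (i + 1)).val = s (f i).val := fun i => by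
    simp only [f, Fin.val_add, hmod, ← iterate_succ_apply' s]
    rw [iterate_add_apply, iterate_succ_apply]
    simp
  refine ⟨RelIso.symm ⟨Equiv.ofBijective f hf, ?_⟩⟩
  intro i j
  change G.Adj (f i).val (f j).val ↔ _
  rw [hG, SimpleGraph.cycleGraph_adj, ← hstep, ← hstep]
  constructor
  · rintro (h | h)
    · right; rw [hf.1 (Subtype.ext h)]; simp
    · left; rw [hf.1 (Subtype.ext h)]; simp
  · rintro (h | h)
    · right; rw [sub_eq_iff_eq_add.1 h, add_comm]
    · left; rw [sub_eq_iff_eq_add.1 h, add_comm]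

/-- The map that applies `σ` on the side `π = true` and `τ` on the side `π = false`. -/
def alternate {V : Type*} (π : V → Bool) (σ τ : V → V) (v : V) : V :=
  if π v then σ v else τ v

/-- The relation `R` is the union of two involutions that exchange the two sides of a
bipartition, and the cycles in which they alternate all have length `m`. -/
def IsAlternating {V : Type*} (R : V → V → Prop) (m : ℕ) : Prop :=
  ∃ (π : V → Bool) (σ τ : V → V), Involutive σ ∧ Involutive τ ∧
    (∀ v, π (σ v) = !π v) ∧ (∀ v, π (τ v) = !π v) ∧
    (∀ u v, R u v ↔ v = σ u ∨ v = τ u) ∧ ∀ v, minimalPeriod (alternate π σ τ) v = m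

/-- The bipartition orients the cycles: on the true side the σ-edge leads forward and the τ-edge
back, on the false side the other way round. -/
theorem IsAlternating.exists_successor {V : Type*} {R : V → V → Prop} {m : ℕ}
    (h : IsAlternating R m) :
    ∃ s : V → V, (∀ v, minimalPeriod s v = m) ∧ ∀ u v, R u v ↔ v = s u ∨ u = s v := by
  obtain ⟨π, σ, τ, hσ, hτ, hπσ, hπτ, hR, hp⟩ := h
  refine ⟨_, hp, fun u v => ?_⟩
  have e1 : v = σ u ↔ u = σ v := ⟨fun h => by rw [h, hσ], fun h => by rw [h, hσ]⟩
  have e2 : v = τ u ↔ u = τ v := ⟨fun h => by rw [h, hτ], fun h => by rw [h, hτ]⟩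
  rw [hR, alternate, alternate]
  cases hu : π u <;> cases hv : π v
  · have : v ≠ σ u := by rintro rfl; simp [hπσ, hu] at hv
    have : v ≠ τ u := by rintro rfl; simp [hπτ, hu] at hv
    simp_all
  · simp [e1]; tauto
  · simp [e2]
  · have : v ≠ σ u := by rintro rfl; simp [hπσ, hu] at hv
    have : v ≠ τ u := by rintro rfl; simp [hπτ, hu] at hv
    simp_all

theorem IsAlternating.isCycleFactor {V W : Type*} {R : V → V → Prop} {m : ℕ}
    (h : IsAlternating R m) (hm : 3 ≤ m) (e : W ≃ V) {G : SimpleGraph W}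
    (hG : ∀ u v, G.Adj u v ↔ R (e u) (e v)) : IsCycleFactor G m := by
  obtain ⟨s, hs, hR⟩ := h.exists_successor
  have hsemi : Semiconj e (fun w => e.symm (s (e w))) s := fun w => by simp
  refine isCycleFactor_of_minimalPeriod hm (fun w => e.symm (s (e w))) (fun v => ?_) fun u v => ?_
  · rw [← hs (e v), minimalPeriod_eq_minimalPeriod_iff]
    intro k
    simp only [IsPeriodicPt, IsFixedPt]
    rw [← (hsemi.iterate_right k) v, e.apply_eq_iff_eq]
  · rw [hG, hR, Equiv.eq_symm_apply, Equiv.eq_symm_apply]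

theorem isOneFactor_of_involutive {W : Type*} {F : SimpleGraph W} (σ : W → W)
    (hF : ∀ u v, F.Adj u v ↔ v = σ u) : IsOneFactor F := by
  refine ⟨fun v _ => ⟨σ v, ?_, fun w hw => ?_⟩, fun v => trivial⟩
  · simp [hF]
  · simpa [hF] using hw

/-- A symmetric edge labelling turns the decomposition into a check of one label class at a time:
disjointness is injectivity of `ℓ`, and covering is `hcover`. -/
theorem hwpHasSolution_of_labelling {V Λ J : Type*} [Fintype V] [Fintype J] {v M N β : ℕ}
    (hV : Fintype.card V = v) (hv : Even v) (hJ : Fintype.card J = β) (hM : 3 ≤ M) (hN : 3 ≤ N)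
    (L : V → V → Λ) (hL : ∀ u w, L u w = L w u) (ℓ : Option (Option J) → Λ) (hℓ : Injective ℓ)
    (hcover : ∀ u w, u ≠ w → ∃ i, L u w = ℓ i)
    (hnone : ∃ σ : V → V, ∀ u w, u ≠ w ∧ L u w = ℓ none ↔ w = σ u)
    (hsome : IsAlternating (fun u w => u ≠ w ∧ L u w = ℓ (some none)) M)
    (hJs : ∀ j, IsAlternating (fun u w => u ≠ w ∧ L u w = ℓ (some (some j))) N) :
    HWPHasSolution v M N 1 β := by
  subst hV hJ
  let e := (Fintype.equivFin V).symm
  let H : Option (Option J) → SimpleGraph (Fin (Fintype.card V)) := fun i =>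
    { Adj := fun a b => e a ≠ e b ∧ L (e a) (e b) = ℓ i
      symm := ⟨fun a b h => ⟨h.1.symm, by rw [hL, h.2]⟩⟩
      loopless := ⟨fun a h => h.1 rfl⟩ }
  let g := (Fintype.equivFin J).symm
  have hdisj : ∀ i j a b, (H i).Adj a b → (H j).Adj a b → i = j := fun i j a b h h' =>
    hℓ (h.2.symm.trans h'.2)
  refine ⟨H none, fun _ => H (some none), fun j => H (some (some (g j))),
    fun h => absurd hv (by simpa using h), fun _ => ?_, fun _ => hsome.isCycleFactor hM e
    fun _ _ => Iff.rfl, fun j => (hJs (g j)).isCycleFactor hN e fun _ _ => Iff.rfl, ?_, ?_⟩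
  · obtain ⟨σ, hσ⟩ := hnone
    refine isOneFactor_of_involutive (fun w => e.symm (σ (e w))) fun a b => ?_
    rw [Equiv.eq_symm_apply]
    exact hσ _ _
  · have key : ∀ i j, i ≠ j → Disjoint (H i).edgeSet (H j).edgeSet := fun i j hij => by
      rw [Set.disjoint_left]
      intro p
      induction p with | _ a b => exact fun h h' => hij (hdisj i j a b h h')
    rintro (i | i) (j | j) hij
    · exact absurd (congrArg Sum.inl (Subsingleton.elim i j)) hij
    · exact key _ _ (by simp)
    · exact key _ _ (by simp)
    · exact key _ _ (by simpa using hij)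
  · ext p
    induction p with | _ a b => ?_
    simp only [Set.mem_iUnion, SimpleGraph.mem_edgeSet, SimpleGraph.sdiff_adj,
      SimpleGraph.top_adj]
    constructor
    · rintro ⟨i | i, h⟩
      · exact ⟨SimpleGraph.Adj.ne h, fun h' => by simpa using hdisj _ _ _ _ h h'⟩
      · exact ⟨SimpleGraph.Adj.ne h, fun h' => by simpa using hdisj _ _ _ _ h h'⟩
    · rintro ⟨hne, h⟩
      have hne' : e a ≠ e b := e.injective.ne hne
      obtain ⟨i, hi⟩ := hcover _ _ hne'
      match i, hi with
      | none, hi => exact absurd ⟨hne', hi⟩ h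
      | some none, hi => exact ⟨Sum.inl 0, hne', hi⟩
      | some (some j), hi => exact ⟨Sum.inr (g.symm j), hne', by simpa using hi⟩

/-! ### Computing minimal periods. -/

/-- A return takes an even number of steps, as each step changes sides. Every double step moves `φ`
by a constant of additive order x, so the number of double steps is a multiple of x. -/
theorem two_mul_dvd_of_iterate_eq {V : Type*} {x : ℕ} {s : V → V} (π : V → Bool)
    (hπ : ∀ v, π (s v) = !π v) (φ : V → ZMod x) (u : Bool → ZMod x)
    (hu : ∀ b (k : ℕ), (k : ZMod x) * u b = 0 → x ∣ k)
    (h : ∀ v, φ (s (s v)) = φ v + u (π v)) {k : ℕ} {v : V} (hk : s^[k] v = v) : 2 * x ∣ k := by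
  have key : ∀ j : ℕ, π (s^[2 * j] v) = π v ∧ φ (s^[2 * j] v) = φ v + j * u (π v) := by
    intro j
    induction j with
    | zero => simp
    | succ j ih =>
      rw [mul_add, mul_one, iterate_succ_apply', iterate_succ_apply', hπ, hπ, h, ih.1, ih.2]
      refine ⟨by simp, ?_⟩
      push_cast
      ring
  rcases Nat.even_or_odd' k with ⟨j, rfl | rfl⟩
  · refine mul_dvd_mul_left 2 (hu (π v) j ?_)
    have := (key j).2
    rw [hk] at this
    simpa using this
  · have := (key j).1
    rw [iterate_succ_apply'] at hk
    have h2 := hπ (s^[2 * j] v)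
    rw [hk, this] at h2
    simp at h2

theorem minimalPeriod_eq_two_mul {V : Type*} {x : ℕ} {s : V → V} (π : V → Bool)
    (hπ : ∀ v, π (s v) = !π v) (φ : V → ZMod x) (u : Bool → ZMod x)
    (hu : ∀ b (k : ℕ), (k : ZMod x) * u b = 0 → x ∣ k)
    (h : ∀ v, φ (s (s v)) = φ v + u (π v)) (hx : ∀ v, s^[2 * x] v = v) (v : V) :
    minimalPeriod s v = 2 * x :=
  Nat.dvd_antisymm (IsPeriodicPt.minimalPeriod_dvd (hx v))
    (two_mul_dvd_of_iterate_eq π hπ φ u hu h iterate_minimalPeriod)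

theorem alternate_flip {V : Type*} {π : V → Bool} {σ τ : V → V} (hσ : ∀ v, π (σ v) = !π v)
    (hτ : ∀ v, π (τ v) = !π v) (v : V) : π (alternate π σ τ v) = !π v := by
  unfold alternate
  split <;> simp [hσ, hτ]

theorem minimalPeriod_eq_card_of_orbit {W : Type*} [Fintype W] {f : W → W} {w₀ : W}
    (h0 : f^[Fintype.card W] w₀ = w₀) (h : ∀ w, ∃ k, f^[k] w₀ = w) (w : W) :
    minimalPeriod f w = Fintype.card W := by
  have hpos : 0 < Fintype.card W := Fintype.card_pos_iff.2 ⟨w₀⟩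
  have hper : w₀ ∈ periodicPts f := ⟨_, hpos, h0⟩
  obtain ⟨k, rfl⟩ := h w
  rw [minimalPeriod_apply_iterate hper]
  refine le_antisymm (IsPeriodicPt.minimalPeriod_le hpos h0) ?_
  have hs : Surjective fun i : Fin (minimalPeriod f w₀) => f^[i.val] w₀ := fun w => by
    obtain ⟨k, rfl⟩ := h w
    exact ⟨⟨k % minimalPeriod f w₀, Nat.mod_lt _ (minimalPeriod_pos_of_mem_periodicPts hper)⟩,
      iterate_mod_minimalPeriod_eq⟩
  simpa using Fintype.card_le_of_surjective _ hs

theorem IsAlternating.congr {V : Type*} {R R' : V → V → Prop} {m : ℕ} (h : IsAlternating R m)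
    (hR : ∀ u v, R' u v ↔ R u v) : IsAlternating R' m := by
  have : R' = R := by ext u v; exact hR u v
  rwa [this]

/-- Disjoint copies indexed by `K`; this carries a Hamilton cycle of one clique to all three. -/
theorem IsAlternating.lift {V K W : Type*} {R : W → W → Prop} {m : ℕ} (h : IsAlternating R m)
    (E : V ≃ K × W) :
    IsAlternating (fun u v => (E v).1 = (E u).1 ∧ R (E u).2 (E v).2) m := by
  obtain ⟨π, σ, τ, hσ, hτ, hπσ, hπτ, hR, hp⟩ := h
  refine ⟨fun v => π (E v).2, fun v => E.symm ((E v).1, σ (E v).2),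
    fun v => E.symm ((E v).1, τ (E v).2), fun v => by simp [hσ _], fun v => by simp [hτ _],
    fun v => by simp [hπσ], fun v => by simp [hπτ], fun u v => ?_, fun v => ?_⟩
  · simp only [Equiv.eq_symm_apply, Prod.ext_iff, hR]
    tauto
  · rw [← hp (E v).2, minimalPeriod_eq_minimalPeriod_iff]
    intro k
    have key : ∀ k : ℕ, E ((alternate (fun v => π (E v).2) (fun v => E.symm ((E v).1, σ (E v).2))
        fun v => E.symm ((E v).1, τ (E v).2))^[k] v) =
        ((E v).1, (alternate π σ τ)^[k] (E v).2) := by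
      intro k
      induction k with
      | zero => simp
      | succ k ih =>
        rw [iterate_succ_apply', iterate_succ_apply']
        generalize (alternate (fun v => π (E v).2) (fun v => E.symm ((E v).1, σ (E v).2))
          fun v => E.symm ((E v).1, τ (E v).2))^[k] v = z at ih ⊢
        generalize (alternate π σ τ)^[k] (E v).2 = y at ih ⊢
        by_cases hy : π y <;> simp [alternate, ih, hy]
    rw [IsPeriodicPt, IsFixedPt, ← E.apply_eq_iff_eq, key, IsPeriodicPt, IsFixedPt, Prod.ext_iff]
    simp

/-! ### Hamilton cycles in K_{4n+2} from the standard one-factorization. -/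

section Clique

variable {n : ℕ}

/-- The colour of an edge of the complete graph on `ZMod (4 * n + 1) ∪ {∞}` in the standard
one-factorization. -/
def cliqueColour : Option (ZMod (4 * n + 1)) → Option (ZMod (4 * n + 1)) → ZMod (4 * n + 1)
  | none, none => 0
  | none, some b => b + b
  | some a, none => a + a
  | some a, some b => a + b

/-- The neighbour along the edge of colour `c + c`. -/
def cliqueMate (c : ZMod (4 * n + 1)) : Option (ZMod (4 * n + 1)) → Option (ZMod (4 * n + 1))
  | none => some c
  | some a => if a = c then none else some (c + c - a)

theorem add_self_inj {a b : ZMod (4 * n + 1)} : a + a = b + b ↔ a = b := by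
  refine ⟨fun h => ?_, fun h => by rw [h]⟩
  -- 2n + 1 is the inverse of 2 modulo 4n + 1, so every colour is c + c for a unique c.
  have h2 : ((2 * n + 1 : ℕ) : ZMod (4 * n + 1)) * 2 = 1 := by
    have := ZMod.natCast_self (4 * n + 1)
    push_cast at this ⊢
    linear_combination this
  linear_combination ((2 * n + 1 : ℕ) : ZMod (4 * n + 1)) * h - (a - b) * h2

theorem cliqueColour_comm (u v : Option (ZMod (4 * n + 1))) :
    cliqueColour u v = cliqueColour v u := by
  cases u <;> cases v <;> simp [cliqueColour, add_comm]

theorem cliqueMate_involutive (c : ZMod (4 * n + 1)) : Involutive (cliqueMate c) := by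
  rintro (_ | a)
  · simp [cliqueMate]
  · by_cases h : a = c
    · simp [cliqueMate, h]
    · have : c + c - a ≠ c := fun h' => h (by linear_combination -h')
      simp [cliqueMate, h, this]

theorem ne_and_cliqueColour_eq_iff {c : ZMod (4 * n + 1)} {u v : Option (ZMod (4 * n + 1))} :
    u ≠ v ∧ cliqueColour u v = c + c ↔ v = cliqueMate c u := by
  rcases u with _ | a <;> rcases v with _ | b
  · simp [cliqueMate]
  · simp [cliqueMate, cliqueColour, add_self_inj]
  · by_cases h : a = c <;> simp [cliqueMate, cliqueColour, add_self_inj, h]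
  · by_cases h : a = c
    · subst h
      simp [cliqueMate, cliqueColour]
      exact fun h h' => h h'.symm
    · simp only [cliqueMate, cliqueColour, h, if_false, ne_eq, Option.some.injEq]
      constructor
      · rintro ⟨-, h⟩
        rw [← h]; ring
      · rintro rfl
        exact ⟨fun h' => h (add_self_inj.1 (by linear_combination h')), by ring⟩

/-- One side of the bipartition of the Hamilton cycle formed by the colours `c + c` and
`c + c + 1`. -/
def cliqueSide (c : ZMod (4 * n + 1)) : Option (ZMod (4 * n + 1)) → Bool
  | none => true
  | some a => decide (1 ≤ (a - c).val ∧ (a - c).val ≤ 2 * n)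

theorem cliqueSide_add {c : ZMod (4 * n + 1)} {t : ℕ} (ht : t < 2 * n) :
    cliqueSide c (some (c + (t + 1 : ℕ))) = true := by
  simp only [cliqueSide, add_sub_cancel_left, ZMod.val_natCast_of_lt (show t + 1 < 4 * n + 1 by omega)]
  simpa using ht

theorem cliqueSide_sub {c : ZMod (4 * n + 1)} {t : ℕ} (ht : t ≤ 2 * n) :
    cliqueSide c (some (c - t)) = false := by
  simp only [cliqueSide, sub_sub_cancel_left, ZMod.neg_val, decide_eq_false_iff_not]
  split_ifs with h
  · simp
  · rw [ZMod.val_natCast_of_lt (by omega)]; omega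

theorem clique_cases (c a : ZMod (4 * n + 1)) :
    (∃ t ≤ 2 * n, a = c - (t : ℕ)) ∨ ∃ t < 2 * n, a = c + (t + 1 : ℕ) := by
  have h := ZMod.natCast_zmod_val (a - c)
  have hlt := ZMod.val_lt (a - c)
  by_cases h1 : 1 ≤ (a - c).val ∧ (a - c).val ≤ 2 * n
  · refine Or.inr ⟨(a - c).val - 1, by omega, ?_⟩
    rw [Nat.sub_add_cancel h1.1, h]; ring
  · left
    by_cases h0 : (a - c).val = 0
    · exact ⟨0, by omega, by rw [h0] at h; linear_combination -h⟩
    · refine ⟨4 * n + 1 - (a - c).val, by omega, ?_⟩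
      rw [Nat.cast_sub hlt.le, h, ZMod.natCast_self]; ring

theorem cast_succ_ne_zero {t : ℕ} (ht : t < 4 * n) : ((t + 1 : ℕ) : ZMod (4 * n + 1)) ≠ 0 := by
  intro h
  have := Nat.le_of_dvd (Nat.succ_pos _) ((ZMod.natCast_eq_zero_iff _ _).1 h)
  omega

theorem cliqueMate_sub_zero (c : ZMod (4 * n + 1)) : cliqueMate c (some (c - (0 : ℕ))) = none := by
  simp [cliqueMate]

theorem cliqueMate_sub_succ {c : ZMod (4 * n + 1)} {t : ℕ} (ht : t < 2 * n) :
    cliqueMate c (some (c - (t + 1 : ℕ))) = some (c + (t + 1 : ℕ)) := by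
  have : c - ((t + 1 : ℕ) : ZMod (4 * n + 1)) ≠ c := fun h =>
    cast_succ_ne_zero (n := n) (t := t) (by omega) (by linear_combination -h)
  rw [cliqueMate, if_neg this]
  ring_nf

theorem cliqueMate_add {c : ZMod (4 * n + 1)} {t : ℕ} (ht : t < 2 * n) :
    cliqueMate c (some (c + (t + 1 : ℕ))) = some (c - (t + 1 : ℕ)) := by
  rw [← cliqueMate_sub_succ ht, cliqueMate_involutive c]

/-- Half of `c + c + 1`. -/
def cliqueNext (c : ZMod (4 * n + 1)) : ZMod (4 * n + 1) := c - (2 * n : ℕ)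

theorem cliqueNext_add_self (c : ZMod (4 * n + 1)) :
    cliqueNext c + cliqueNext c = c + c + 1 := by
  have := ZMod.natCast_self (4 * n + 1)
  push_cast [cliqueNext] at this ⊢
  linear_combination -this

theorem cliqueMate_next_sub {c : ZMod (4 * n + 1)} {t : ℕ} (ht : t < 2 * n) :
    cliqueMate (cliqueNext c) (some (c - t)) = some (c + (t + 1 : ℕ)) := by
  have : c - (t : ZMod (4 * n + 1)) ≠ cliqueNext c := fun h => by
    refine cast_succ_ne_zero (n := n) (t := 2 * n - t - 1) (by omega) ?_
    rw [Nat.sub_add_cancel (by omega), Nat.cast_sub ht.le]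
    unfold cliqueNext at h
    linear_combination h
  rw [cliqueMate, if_neg this, cliqueNext_add_self]
  push_cast
  ring_nf

theorem cliqueMate_next_last (c : ZMod (4 * n + 1)) :
    cliqueMate (cliqueNext c) (some (c - (2 * n : ℕ))) = none := by
  simp [cliqueMate, cliqueNext]

theorem cliqueMate_next_add {c : ZMod (4 * n + 1)} {t : ℕ} (ht : t < 2 * n) :
    cliqueMate (cliqueNext c) (some (c + (t + 1 : ℕ))) = some (c - t) := by
  rw [← cliqueMate_next_sub ht, cliqueMate_involutive]

theorem cliqueSide_mate (c : ZMod (4 * n + 1)) (u : Option (ZMod (4 * n + 1))) :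
    cliqueSide c (cliqueMate c u) = !cliqueSide c u := by
  rcases u with _ | a
  · simp [cliqueMate, cliqueSide]
  · rcases clique_cases c a with ⟨t, ht, rfl⟩ | ⟨t, ht, rfl⟩
    · rw [cliqueSide_sub ht]
      rcases t with _ | t
      · rw [cliqueMate_sub_zero]; rfl
      · rw [cliqueMate_sub_succ (by omega), cliqueSide_add (by omega)]; rfl
    · rw [cliqueMate_add ht, cliqueSide_add ht, cliqueSide_sub (by omega)]; rfl

theorem cliqueSide_mate_next (c : ZMod (4 * n + 1)) (u : Option (ZMod (4 * n + 1))) :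
    cliqueSide c (cliqueMate (cliqueNext c) u) = !cliqueSide c u := by
  rcases u with _ | a
  · change cliqueSide c (some (c - (2 * n : ℕ))) = _
    rw [cliqueSide_sub le_rfl]; rfl
  · rcases clique_cases c a with ⟨t, ht, rfl⟩ | ⟨t, ht, rfl⟩
    · rw [cliqueSide_sub ht]
      rcases ht.lt_or_eq with h | rfl
      · rw [cliqueMate_next_sub h, cliqueSide_add h]; rfl
      · rw [cliqueMate_next_last]; rfl
    · rw [cliqueMate_next_add ht, cliqueSide_add ht, cliqueSide_sub (by omega)]; rfl

/-- The walk is the zigzag ∞, c, c+1, c-1, c+2, c-2, ..., because the reflections a ↦ 2c - a and a ↦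
2c + 1 - a compose to a translation by one. -/
theorem clique_iterate (c : ZMod (4 * n + 1)) {t : ℕ} (ht : t ≤ 2 * n) :
    (alternate (cliqueSide c) (cliqueMate c) (cliqueMate (cliqueNext c)))^[2 * t + 1] none =
      some (c - t) := by
  induction t with
  | zero => simp [alternate, cliqueSide, cliqueMate]
  | succ t ih =>
    rw [show 2 * (t + 1) + 1 = (2 * t + 1) + 1 + 1 by ring, iterate_succ_apply',
      iterate_succ_apply', ih (by omega)]
    have h1 : alternate (cliqueSide c) (cliqueMate c) (cliqueMate (cliqueNext c))
        (some (c - t)) = some (c + (t + 1 : ℕ)) := by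
      rw [alternate, cliqueSide_sub (by omega), ← cliqueMate_next_sub (by omega)]; rfl
    rw [h1, alternate, cliqueSide_add (by omega), ← cliqueMate_add (by omega)]; rfl

theorem isAlternating_clique (c : ZMod (4 * n + 1)) :
    IsAlternating (fun u v => u ≠ v ∧ (cliqueColour u v = c + c ∨ cliqueColour u v = c + c + 1))
      (2 * (2 * n + 1)) := by
  refine ⟨cliqueSide c, cliqueMate c, cliqueMate (cliqueNext c), cliqueMate_involutive c,
    cliqueMate_involutive _, cliqueSide_mate c, cliqueSide_mate_next c, fun u v => ?_, ?_⟩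
  · rw [← ne_and_cliqueColour_eq_iff, ← ne_and_cliqueColour_eq_iff, cliqueNext_add_self]
    tauto
  · have hcard : Fintype.card (Option (ZMod (4 * n + 1))) = 2 * (2 * n + 1) := by
      rw [Fintype.card_option, ZMod.card]; ring
    rw [← hcard]
    apply minimalPeriod_eq_card_of_orbit (w₀ := none)
    · rw [hcard, show 2 * (2 * n + 1) = 2 * (2 * n) + 1 + 1 by ring, iterate_succ_apply',
        clique_iterate c le_rfl, alternate, cliqueSide_sub le_rfl, ← cliqueMate_next_last c]
      rfl
    · rintro (_ | a)
      · exact ⟨0, rfl⟩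
      · rcases clique_cases c a with ⟨t, ht, rfl⟩ | ⟨t, ht, rfl⟩
        · exact ⟨_, clique_iterate c ht⟩
        · refine ⟨2 * t + 1 + 1, ?_⟩
          rw [iterate_succ_apply', clique_iterate c ht.le, alternate, cliqueSide_sub ht.le,
            ← cliqueMate_next_sub ht]
          rfl

end Clique

/-! ### Matchings of K_6 and the edges of constant difference over them. -/

/-- Four pairwise disjoint perfect matchings of the complete graph on `ZMod 6`. -/
def partner : Fin 4 → ZMod 6 → ZMod 6 :=
  ![![2, 4, 0, 5, 1, 3], ![3, 5, 4, 0, 2, 1], ![1, 0, 3, 2, 5, 4], ![5, 2, 1, 4, 3, 0]]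

/-- An orientation of the four matchings. -/
def isLower : Fin 4 → ZMod 6 → Bool :=
  ![![true, true, false, true, false, false], ![true, true, true, false, false, false],
    ![true, false, true, false, true, false], ![true, false, true, false, true, false]]

/-- The edge `{0, 4}`, `{1, 3}` or `{2, 5}` of the fifth matching that contains a point. -/
def fifthEdge : ZMod 6 → Fin 3 := ![0, 1, 2, 1, 0, 2]

/-- The matching that contains the edge `p q`, if it is one of the four. -/
def matchingOf (p q : ZMod 6) : Option (Fin 4) :=
  if q = partner 0 p then some 0 else if q = partner 1 p then some 1
  else if q = partner 2 p then some 2 else if q = partner 3 p then some 3 else none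

theorem partner_partner : ∀ c p, partner c (partner c p) = p := by decide

theorem partner_ne : ∀ c p, partner c p ≠ p := by decide

theorem isLower_partner : ∀ c p, isLower c (partner c p) = !isLower c p := by decide

theorem matchingOf_eq_some : ∀ p q c, matchingOf p q = some c ↔ q = partner c p := by decide

theorem matchingOf_eq_none : ∀ p q, matchingOf p q = none ↔ fifthEdge q = fifthEdge p := by decide

theorem matchingOf_comm : ∀ p q, matchingOf p q = matchingOf q p := by decide

theorem isLower_three : ∀ p, isLower 3 p = isLower 2 p := by decide

/-- The two fibres over an edge of the fifth matching may be identified with the clique arbitrarily,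
since all their edges belong to the clique. -/
theorem exists_pointEquiv (n : ℕ) :
    ∃ E : ZMod 6 × ZMod (2 * n + 1) ≃ Fin 3 × Option (ZMod (4 * n + 1)),
      ∀ u, (E u).1 = fifthEdge u.1 := by
  -- `isLower 1` serves here only because it separates the two ends of each edge of the fifth
  -- matching.
  have hb : Bijective fun p : ZMod 6 => (fifthEdge p, isLower 1 p) := by decide
  have hc : Fintype.card (Bool × ZMod (2 * n + 1)) =
      Fintype.card (Option (ZMod (4 * n + 1))) := by
    rw [Fintype.card_prod, Fintype.card_option, ZMod.card, ZMod.card, Fintype.card_bool]; ring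
  exact ⟨((Equiv.ofBijective _ hb).prodCongr (Equiv.refl _)).trans
    ((Equiv.prodAssoc _ _ _).trans ((Equiv.refl _).prodCongr (Fintype.equivOfCardEq hc))),
    fun u => rfl⟩

/-- The difference of an edge in the matching `c`, from the lower end to the upper end. -/
def edgeDiff {x : ℕ} (c : Fin 4) (u v : ZMod 6 × ZMod x) : ZMod x :=
  if isLower c u.1 then v.2 - u.2 else u.2 - v.2

/-- The second coordinate of the lower end of an edge in the matching `c`. -/
def edgeBase {x : ℕ} (c : Fin 4) (u v : ZMod 6 × ZMod x) : ZMod x :=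
  if isLower c u.1 then u.2 else v.2

/-- The edges of difference `d` in the matching `c`. -/
def shift {x : ℕ} (c : Fin 4) (d : ZMod x) (u : ZMod 6 × ZMod x) : ZMod 6 × ZMod x :=
  (partner c u.1, if isLower c u.1 then u.2 + d else u.2 - d)

theorem shift_involutive {x : ℕ} (c : Fin 4) (d : ZMod x) : Involutive (shift c d) := by
  intro u
  cases h : isLower c u.1 <;> simp [shift, partner_partner, isLower_partner, h]

theorem eq_shift_iff {x : ℕ} {c : Fin 4} {d : ZMod x} {u v : ZMod 6 × ZMod x} :
    v = shift c d u ↔ v.1 = partner c u.1 ∧ edgeDiff c u v = d := by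
  rw [shift, Prod.ext_iff, edgeDiff]
  refine and_congr_right fun _ => ?_
  split
  · exact ⟨fun h => by rw [h]; ring, fun h => by rw [← h]; ring⟩
  · exact ⟨fun h => by rw [h]; ring, fun h => by rw [← h]; ring⟩

theorem dvd_of_mul_unit_eq_zero {x k : ℕ} {w w' : ZMod x} (hw : w * w' = 1)
    (h : (k : ZMod x) * w = 0) : x ∣ k := by
  rw [← ZMod.natCast_eq_zero_iff]
  linear_combination w' * h - k * hw

/-- From either side a double step keeps the first coordinate and moves the second by -1, so each
cycle covers both fibres over an edge of the matching. -/
theorem isAlternating_shift {x : ℕ} (c : Fin 4) (d : ZMod x) :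
    IsAlternating (fun u v : ZMod 6 × ZMod x =>
      v.1 = partner c u.1 ∧ (edgeDiff c u v = d ∨ edgeDiff c u v = d + 1)) (2 * x) := by
  have h1 : ∀ u : ZMod 6 × ZMod x, isLower c (shift c d u).1 = !isLower c u.1 :=
    fun u => isLower_partner _ _
  have h2 : ∀ u : ZMod 6 × ZMod x, isLower c (shift c (d + 1) u).1 = !isLower c u.1 :=
    fun u => isLower_partner _ _
  refine ⟨fun u => isLower c u.1, shift c d, shift c (d + 1), shift_involutive _ _,
    shift_involutive _ _, h1, h2, fun u v => ?_, ?_⟩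
  · rw [eq_shift_iff, eq_shift_iff]; tauto
  · have key : ∀ u : ZMod 6 × ZMod x,
        alternate (fun u => isLower c u.1) (shift c d) (shift c (d + 1))
          (alternate (fun u => isLower c u.1) (shift c d) (shift c (d + 1)) u) =
        (u.1, u.2 - 1) := fun u => by
      cases h : isLower c u.1 <;>
        simp [alternate, shift, h, isLower_partner, partner_partner] <;> ring
    refine minimalPeriod_eq_two_mul (fun u => isLower c u.1)
      (alternate_flip (π := fun u : ZMod 6 × ZMod x => isLower c u.1) h1 h2) Prod.snd
      (fun _ => -1) (fun _ k => dvd_of_mul_unit_eq_zero (w' := -1) (by ring))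
      (fun u => by rw [key]; simp [sub_eq_add_neg]) fun u => ?_
    have : ∀ k : ℕ, (alternate (fun u => isLower c u.1) (shift c d) (shift c (d + 1)))^[2 * k] u =
        (u.1, u.2 - k) := by
      intro k
      induction k with
      | zero => simp
      | succ k ih =>
        rw [mul_add, mul_one, iterate_succ_apply', iterate_succ_apply', ih, key]
        push_cast
        ring_nf
    rw [this]; simp

theorem isAlternating_hexagon (x : ℕ) :
    IsAlternating (fun u v : ZMod 6 × ZMod x =>
      (v.1 = partner 0 u.1 ∨ v.1 = partner 1 u.1) ∧ v.2 = u.2) 6 := by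
  -- Matchings 0 and 1 form the hexagon 0, 2, 4, 1, 5, 3; `f` is its 2-colouring.
  let f : ZMod 6 → Bool := ![true, false, false, false, true, true]
  have h0 : ∀ p, f (partner 0 p) = !f p := by decide
  have h1 : ∀ p, f (partner 1 p) = !f p := by decide
  have h6 : ∀ p, (alternate f (partner 0) (partner 1))^[6] p = p := by decide
  have hlt : ∀ p, ∀ k < 6, 0 < k → (alternate f (partner 0) (partner 1))^[k] p ≠ p := by decide
  refine ⟨fun u => f u.1, fun u => (partner 0 u.1, u.2), fun u => (partner 1 u.1, u.2),
    fun u => by simp [partner_partner], fun u => by simp [partner_partner], fun u => h0 _,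
    fun u => h1 _, fun u v => by simp [Prod.ext_iff]; tauto, fun u => ?_⟩
  have hk : ∀ k : ℕ, (alternate (fun u : ZMod 6 × ZMod x => f u.1)
      (fun u => (partner 0 u.1, u.2)) fun u => (partner 1 u.1, u.2))^[k] u =
      ((alternate f (partner 0) (partner 1))^[k] u.1, u.2) := by
    intro k
    induction k with
    | zero => rfl
    | succ k ih =>
      rw [iterate_succ_apply', iterate_succ_apply', ih]
      generalize (alternate f (partner 0) (partner 1))^[k] u.1 = y
      by_cases hy : f y <;> simp [alternate, hy]
  generalize alternate (fun u : ZMod 6 × ZMod x => f u.1)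
    (fun u => (partner 0 u.1, u.2)) (fun u => (partner 1 u.1, u.2)) = s at hk ⊢
  have hs : IsPeriodicPt s 6 u := (hk 6).trans (by rw [h6])
  refine le_antisymm (hs.minimalPeriod_le (by norm_num)) (not_lt.1 fun h => ?_)
  refine hlt u.1 _ h (hs.minimalPeriod_pos (by norm_num)) ?_
  exact congrArg Prod.fst ((hk _).symm.trans iterate_minimalPeriod)

/-! ### Factors that mix matchings 2 and 3. -/

/-- The edges of difference `d` in the third matching at the lower ends in `T`, and in the fourth
matching at the other lower ends. -/
def mixedShift {x : ℕ} (T : ZMod x → Bool) (d : ZMod x) (u : ZMod 6 × ZMod x) :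
    ZMod 6 × ZMod x :=
  if isLower 2 u.1 then (partner (if T u.2 then 2 else 3) u.1, u.2 + d)
  else (partner (if T (u.2 - d) then 2 else 3) u.1, u.2 - d)

theorem isLower_two_partner (b : Bool) (p : ZMod 6) :
    isLower 2 (partner (if b then 2 else 3) p) = !isLower 2 p := by
  cases b
  · rw [← isLower_three, ← isLower_three]; exact isLower_partner _ _
  · exact isLower_partner _ _

theorem isLower_mixedShift {x : ℕ} (T : ZMod x → Bool) (d : ZMod x) (u : ZMod 6 × ZMod x) :
    isLower 2 (mixedShift T d u).1 = !isLower 2 u.1 := by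
  unfold mixedShift
  split <;> exact isLower_two_partner _ _

theorem mixedShift_involutive {x : ℕ} (T : ZMod x → Bool) (d : ZMod x) :
    Involutive (mixedShift T d) := by
  intro u
  have hu := isLower_mixedShift T d u
  cases h : isLower 2 u.1
  · have hm : mixedShift T d u = (partner (if T (u.2 - d) then 2 else 3) u.1, u.2 - d) := by
      simp [mixedShift, h]
    rw [hm, h] at hu
    rw [hm, mixedShift, if_pos (by simpa using hu), partner_partner, sub_add_cancel]
  · have hm : mixedShift T d u = (partner (if T u.2 then 2 else 3) u.1, u.2 + d) := by
      simp [mixedShift, h]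
    rw [hm, h] at hu
    rw [hm, mixedShift, if_neg (by simp [hu]), add_sub_cancel_right, partner_partner]

theorem eq_mixedShift_iff {x : ℕ} {T : ZMod x → Bool} {d : ZMod x} {u v : ZMod 6 × ZMod x} :
    v = mixedShift T d u ↔
      v.1 = partner (if T (edgeBase 2 u v) then 2 else 3) u.1 ∧ edgeDiff 2 u v = d := by
  unfold mixedShift edgeBase edgeDiff
  cases h : isLower 2 u.1
  · simp only [Bool.false_eq_true, if_false, Prod.ext_iff]
    constructor
    · rintro ⟨h1, h2⟩; rw [h2]; exact ⟨h1, by ring⟩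
    · rintro ⟨h1, rfl⟩; rw [sub_sub_cancel]; exact ⟨h1, rfl⟩
  · simp only [if_true, Prod.ext_iff]
    exact and_congr_right fun _ =>
      ⟨fun h => by rw [h]; ring, fun h => by rw [← h]; ring⟩

/-- `1` for `true` and `-1` for `false`. -/
def boolSign (b : Bool) : ZMod 6 := if b then 1 else -1

theorem partner_of_isLower : ∀ (b : Bool) (p : ZMod 6), isLower 2 p = true →
    partner (if b then 2 else 3) p = p + boolSign b := by decide

theorem partner_of_not_isLower : ∀ (b : Bool) (p : ZMod 6), isLower 2 p = false →
    partner (if b then 2 else 3) p = p - boolSign b := by decide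

theorem boolSign_not (b : Bool) : boolSign (!b) = -boolSign b := by
  cases b <;> simp [boolSign]

/-- The sum is 2(r - (x - r)) = 2(2r - x), which vanishes mod 6 exactly when 2r ≡ x mod 3. -/
theorem sum_boolSign {x : ℕ} [NeZero x] {T : ZMod x → Bool} {r : ℕ}
    (hT : (Finset.univ.filter fun a => T a = true).card = r) (hr : 2 * r ≡ x [MOD 3]) :
    ∑ a, 2 * boolSign (T a) = 0 := by
  have h1 : ∀ a, 2 * boolSign (T a) = (if T a = true then 4 else 0) - 2 := fun a => by
    cases T a <;> decide
  simp only [h1, Finset.sum_sub_distrib, ← Finset.sum_filter, Finset.sum_const, hT,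
    Finset.card_univ, ZMod.card, nsmul_eq_mul]
  have h2 : (((2 * (2 * r) : ℕ)) : ZMod 6) = ((2 * x : ℕ) : ZMod 6) :=
    (ZMod.natCast_eq_natCast_iff _ _ _).2 (Nat.ModEq.mul_left' 2 hr)
  push_cast at h2
  linear_combination h2

/-- As w is a unit, the progression a, a + w, a + 2w, ... meets every residue once in x steps. -/
theorem sum_range_orbit {x : ℕ} [NeZero x] (g : ZMod x → ZMod 6) {w w' : ZMod x}
    (hw : w * w' = 1) (a : ZMod x) : ∑ i ∈ Finset.range x, g (a + i * w) = ∑ z, g z := by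
  refine Finset.sum_bij' (fun i _ => a + i * w) (fun z _ => ((z - a) * w').val) (by simp)
    (fun z _ => by simpa using ZMod.val_lt _) (fun i hi => ?_) (fun z _ => ?_) (fun _ _ => rfl)
  · have : (a + i * w - a) * w' = (i : ZMod x) := by linear_combination (i : ZMod x) * hw
    rw [this, ZMod.val_natCast_of_lt (Finset.mem_range.1 hi)]
  · rw [ZMod.natCast_zmod_val]
    linear_combination (z - a) * hw

/-- A double step moves the second coordinate by the unit d - e, so the period is a multiple of 2x.
In 2x steps each residue contributes its sign twice to the first coordinate, and `sum_boolSign`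
makes the total zero. -/
theorem isAlternating_mixedShift {x : ℕ} [NeZero x] {T : ZMod x → Bool} {r : ℕ}
    (hT : (Finset.univ.filter fun a => T a = true).card = r) (hr : 2 * r ≡ x [MOD 3])
    {d e w' : ZMod x} (hw : (d - e) * w' = 1) :
    IsAlternating (fun u v => v = mixedShift T d u ∨ v = mixedShift (fun a => !T a) e u)
      (2 * x) := by
  refine ⟨fun u => isLower 2 u.1, _, _, mixedShift_involutive T d, mixedShift_involutive _ e,
    isLower_mixedShift _ _, isLower_mixedShift _ _, fun u v => Iff.rfl, ?_⟩
  set s := alternate (fun u : ZMod 6 × ZMod x => isLower 2 u.1) (mixedShift T d)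
    (mixedShift (fun a => !T a) e) with hs
  have hflip : ∀ u, isLower 2 (s u).1 = !isLower 2 u.1 :=
    alternate_flip (π := fun u : ZMod 6 × ZMod x => isLower 2 u.1) (isLower_mixedShift _ _) (isLower_mixedShift _ _)
  have h1 : ∀ p a, isLower 2 p = true → s (p, a) = (p + boolSign (T a), a + d) :=
    fun p a h => by simp [hs, alternate, mixedShift, h, partner_of_isLower]
  -- Traversing an edge from its upper end reverses the sign, and complementing `T` reverses it
  -- again; hence the sign of `T` at the lower end governs both kinds of step.
  have h2 : ∀ p a, isLower 2 p = false → s (p, a) = (p + boolSign (T (a - e)), a - e) :=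
    fun p a h => by
      have := partner_of_not_isLower (!T (a - e)) p h
      rw [boolSign_not, sub_neg_eq_add] at this
      simpa [hs, alternate, mixedShift, h] using this
  -- `g b a` is the displacement around the hexagon in a double step that starts over a, on side b.
  let g : Bool → ZMod x → ZMod 6 := fun b a =>
    if b then boolSign (T a) + boolSign (T (a + (d - e))) else 2 * boolSign (T (a - e))
  have hg : ∀ b, ∑ z, g b z = 0 := by
    have h0 := sum_boolSign hT hr
    rintro (_ | _)
    · simp only [g, Bool.false_eq_true, if_false]
      rw [← h0]
      exact Equiv.sum_comp (Equiv.subRight e) fun a => 2 * boolSign (T a)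
    · simp only [g, if_true]
      have h3 : ∑ a, boolSign (T (a + (d - e))) = ∑ a, boolSign (T a) :=
        Equiv.sum_comp (Equiv.addRight (d - e)) fun a => boolSign (T a)
      rw [Finset.sum_add_distrib, h3, ← h0, ← Finset.mul_sum, two_mul]
  have hss : ∀ u, s (s u) = (u.1 + g (isLower 2 u.1) u.2, u.2 + (d - e)) := by
    rintro ⟨p, a⟩
    have hf := hflip (p, a)
    cases h : isLower 2 p
    · rw [h2 p a h] at hf ⊢
      rw [h1 _ _ (by simpa [h] using hf)]
      ext <;> simp [g] <;> ring
    · rw [h1 p a h] at hf ⊢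
      rw [h2 _ _ (by simpa [h] using hf)]
      ext
      · simp [g, add_assoc, add_sub_assoc]
      · simp [add_sub_assoc]
  refine minimalPeriod_eq_two_mul (fun u => isLower 2 u.1) hflip Prod.snd (fun _ => d - e)
    (fun _ k => dvd_of_mul_unit_eq_zero hw) (fun u => by rw [hss]) fun u => ?_
  have key : ∀ k : ℕ, isLower 2 (s^[2 * k] u).1 = isLower 2 u.1 ∧ s^[2 * k] u =
      (u.1 + ∑ i ∈ Finset.range k, g (isLower 2 u.1) (u.2 + i * (d - e)), u.2 + k * (d - e)) := by
    intro k
    induction k with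
    | zero => simp
    | succ k ih =>
      rw [mul_add, mul_one, iterate_succ_apply', iterate_succ_apply']
      refine ⟨by rw [hflip, hflip, ih.1]; simp, ?_⟩
      rw [hss, ih.1, ih.2, Finset.sum_range_succ]
      ext
      · simp [add_assoc]
      · simp only; push_cast; ring
  rw [(key x).2, sum_range_orbit _ hw, hg]
  simp

/-! ### The edge labelling and its classes. -/

/-- The names of the factors. -/
inductive FactorLabel
  | oneFactor
  | hexagon
  | clique (i : ℕ)
  | mixed (c : Fin 4) (i : ℕ)
  | special (t : ℕ)

/-- The factor of an edge of the matching `c` with difference `d` and lower end over `a`. -/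
def matchingLabel {x : ℕ} (T : ZMod x → Bool) (c : Fin 4) (d a : ZMod x) : FactorLabel :=
  if c < 2 then (if d.val = 0 then .hexagon else .mixed c ((d.val - 1) / 2))
  else if d.val < 3 then .special (if T a = decide (c = 2) then d.val else (d.val + 2) % 3)
  else .mixed c ((d.val - 1) / 2)

/-- The factor of an edge of colour `c` over the fifth matching. -/
def cliqueLabel {n : ℕ} (c : ZMod (4 * n + 1)) : FactorLabel :=
  if c.val = 4 * n then .oneFactor else .clique (c.val / 2)

/-- The factor of an edge of the complete graph on `ZMod 6 × ZMod (2 * n + 1)`. -/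
def factorLabel {n : ℕ} (T : ZMod (2 * n + 1) → Bool)
    (E : ZMod 6 × ZMod (2 * n + 1) ≃ Fin 3 × Option (ZMod (4 * n + 1)))
    (u v : ZMod 6 × ZMod (2 * n + 1)) : FactorLabel :=
  match matchingOf u.1 v.1 with
  | some c => matchingLabel T c (edgeDiff c u v) (edgeBase c u v)
  | none => cliqueLabel (cliqueColour (E u).2 (E v).2)

theorem eq_natCast_iff_val {x : ℕ} [NeZero x] {c : ZMod x} {k : ℕ} (hk : k < x) :
    c = k ↔ c.val = k := by
  constructor
  · rintro rfl; exact ZMod.val_natCast_of_lt hk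
  · rintro rfl; exact (ZMod.natCast_zmod_val c).symm

theorem edgeDiff_three {x : ℕ} (u v : ZMod 6 × ZMod x) : edgeDiff 3 u v = edgeDiff 2 u v := by
  rw [edgeDiff, edgeDiff, isLower_three]

theorem edgeBase_three {x : ℕ} (u v : ZMod 6 × ZMod x) : edgeBase 3 u v = edgeBase 2 u v := by
  rw [edgeBase, edgeBase, isLower_three]

section

variable {n : ℕ} {T : ZMod (2 * n + 1) → Bool}
  {E : ZMod 6 × ZMod (2 * n + 1) ≃ Fin 3 × Option (ZMod (4 * n + 1))}

theorem factorLabel_comm (u v : ZMod 6 × ZMod (2 * n + 1)) :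
    factorLabel T E u v = factorLabel T E v u := by
  unfold factorLabel
  rw [matchingOf_comm v.1 u.1, cliqueColour_comm]
  rcases h : matchingOf u.1 v.1 with _ | c
  · rfl
  · have hv := (matchingOf_eq_some _ _ _).1 h
    have hl : isLower c v.1 = !isLower c u.1 := by rw [hv, isLower_partner]
    have h1 : edgeDiff c u v = edgeDiff c v u := by
      unfold edgeDiff; rw [hl]; cases isLower c u.1 <;> simp
    have h2 : edgeBase c u v = edgeBase c v u := by
      unfold edgeBase; rw [hl]; cases isLower c u.1 <;> simp
    simp only [h1, h2]

/-- The pair i = 0 is excluded in matchings 2 and 3, where the differences 1 and 2 go to the special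
factors. -/
theorem mixed_iff {c : Fin 4} {i : ℕ} (hi : i < n) (hc : c < 2 ∨ 0 < i)
    {u v : ZMod 6 × ZMod (2 * n + 1)} :
    u ≠ v ∧ factorLabel T E u v = .mixed c i ↔ v.1 = partner c u.1 ∧
      (edgeDiff c u v = (2 * i + 1 : ℕ) ∨ edgeDiff c u v = (2 * i + 1 : ℕ) + 1) := by
  have key : ∀ c' : Fin 4, ∀ d a : ZMod (2 * n + 1), matchingLabel T c' d a = .mixed c i ↔
      c' = c ∧ (d.val = 2 * i + 1 ∨ d.val = 2 * i + 1 + 1) := by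
    intro c' d a
    unfold matchingLabel
    split_ifs with h1 h2 h2
    · simp; omega
    · simp; omega
    · simp only [false_iff]
      rintro ⟨rfl, h⟩
      have := hc.resolve_left h1
      omega
    · simp; omega
  rw [← Nat.cast_succ, eq_natCast_iff_val (by omega), eq_natCast_iff_val (by omega),
    ← matchingOf_eq_some]
  unfold factorLabel
  rcases h : matchingOf u.1 v.1 with _ | c'
  · simp only [cliqueLabel]
    split_ifs <;> simp
  · have hne : u ≠ v := by
      rintro rfl
      exact partner_ne _ _ ((matchingOf_eq_some _ _ _).1 h).symm
    simp only [key, Option.some.injEq]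
    constructor
    · rintro ⟨-, rfl, h⟩; exact ⟨rfl, h⟩
    · rintro ⟨rfl, h⟩; exact ⟨hne, rfl, h⟩

theorem hexagon_iff {u v : ZMod 6 × ZMod (2 * n + 1)} :
    u ≠ v ∧ factorLabel T E u v = .hexagon ↔
      (v.1 = partner 0 u.1 ∨ v.1 = partner 1 u.1) ∧ v.2 = u.2 := by
  have key : ∀ c : Fin 4, ∀ a : ZMod (2 * n + 1),
      matchingLabel T c (edgeDiff c u v) a = .hexagon ↔ (c = 0 ∨ c = 1) ∧ v.2 = u.2 := by
    intro c a
    have hd : (edgeDiff c u v).val = 0 ↔ v.2 = u.2 := by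
      rw [ZMod.val_eq_zero, edgeDiff]
      split <;> simp [sub_eq_zero, eq_comm]
    have hc : ∀ c : Fin 4, c < 2 ↔ c = 0 ∨ c = 1 := by decide
    unfold matchingLabel
    simp only [hc, hd]
    split_ifs <;> simp_all
  rw [← matchingOf_eq_some, ← matchingOf_eq_some]
  unfold factorLabel
  rcases h : matchingOf u.1 v.1 with _ | c
  · simp only [cliqueLabel]
    split_ifs <;> simp
  · have hne : u ≠ v := by
      rintro rfl
      exact partner_ne _ _ ((matchingOf_eq_some _ _ _).1 h).symm
    simp [key, hne]

/-- Factor t takes difference t with `T` and t + 1 mod 3 with the complement. An edge of the second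
kind with difference d thus has t ≡ d - 1 ≡ d + 2 mod 3, the value in `matchingLabel`. -/
theorem special_iff (hn : 2 ≤ n) {t : ℕ} (ht : t < 3) {u v : ZMod 6 × ZMod (2 * n + 1)} :
    u ≠ v ∧ factorLabel T E u v = .special t ↔
      v = mixedShift T t u ∨ v = mixedShift (fun a => !T a) ((t + 1) % 3 : ℕ) u := by
  rw [eq_mixedShift_iff, eq_mixedShift_iff, eq_natCast_iff_val (by omega),
    eq_natCast_iff_val (by omega), ← matchingOf_eq_some, ← matchingOf_eq_some]
  unfold factorLabel
  rcases h : matchingOf u.1 v.1 with _ | c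
  · simp only [cliqueLabel]
    split_ifs <;> simp
  · have hne : u ≠ v := by
      rintro rfl
      exact partner_ne _ _ ((matchingOf_eq_some _ _ _).1 h).symm
    simp only [hne, ne_eq, not_false_eq_true, true_and, Option.some.injEq]
    fin_cases c
    · simp [matchingLabel]
      split_ifs <;> simp
    · simp [matchingLabel]
      split_ifs <;> simp
    · simp only [matchingLabel, Fin.reduceFinMk]
      generalize (edgeDiff _ u v).val = d
      cases T (edgeBase 2 u v) <;> simp <;> split_ifs <;> simp <;> omega
    · simp only [matchingLabel]
      have h1 := edgeDiff_three u v
      have h2 := edgeBase_three u v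
      simp only [Fin.reduceFinMk, h1, h2]
      generalize (edgeDiff _ u v).val = d
      cases T (edgeBase 2 u v) <;> simp <;> split_ifs <;> simp <;> omega

theorem clique_iff_aux (hE : ∀ u, (E u).1 = fifthEdge u.1) {ℓ : FactorLabel}
    (hℓ : ∀ c (d a : ZMod (2 * n + 1)), matchingLabel T c d a ≠ ℓ)
    {u v : ZMod 6 × ZMod (2 * n + 1)} :
    u ≠ v ∧ factorLabel T E u v = ℓ ↔ (E v).1 = (E u).1 ∧ (E u).2 ≠ (E v).2 ∧
      cliqueLabel (cliqueColour (E u).2 (E v).2) = ℓ := by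
  rw [hE, hE, ← matchingOf_eq_none]
  unfold factorLabel
  rcases h : matchingOf u.1 v.1 with _ | c
  · have h1 : (E u).1 = (E v).1 := by rw [hE, hE, (matchingOf_eq_none _ _).1 h]
    simp only [true_and, ← E.injective.ne_iff, ne_eq, Prod.ext_iff, h1]
  · simp [hℓ]

theorem clique_iff (hE : ∀ u, (E u).1 = fifthEdge u.1) {i : ℕ} (hi : i < 2 * n)
    {u v : ZMod 6 × ZMod (2 * n + 1)} :
    u ≠ v ∧ factorLabel T E u v = .clique i ↔ (E v).1 = (E u).1 ∧ (E u).2 ≠ (E v).2 ∧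
      (cliqueColour (E u).2 (E v).2 = (i + i : ZMod (4 * n + 1)) ∨
        cliqueColour (E u).2 (E v).2 = (i + i + 1 : ZMod (4 * n + 1))) := by
  rw [clique_iff_aux hE fun c d a => by unfold matchingLabel; split_ifs <;> simp]
  rw [← Nat.cast_add, ← Nat.cast_succ, eq_natCast_iff_val (by omega),
    eq_natCast_iff_val (by omega)]
  generalize (cliqueColour (E u).2 (E v).2) = c
  have : cliqueLabel c = .clique i ↔ c.val = i + i ∨ c.val = i + i + 1 := by
    unfold cliqueLabel
    split_ifs <;> simp <;> omega
  rw [this]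

theorem oneFactor_iff (hE : ∀ u, (E u).1 = fifthEdge u.1) {u v : ZMod 6 × ZMod (2 * n + 1)} :
    u ≠ v ∧ factorLabel T E u v = .oneFactor ↔
      v = E.symm ((E u).1, cliqueMate (2 * n : ℕ) (E u).2) := by
  rw [clique_iff_aux hE fun c d a => by unfold matchingLabel; split_ifs <;> simp]
  rw [Equiv.eq_symm_apply, Prod.ext_iff, ← ne_and_cliqueColour_eq_iff, ← Nat.cast_add,
    eq_natCast_iff_val (by omega)]
  generalize (cliqueColour (E u).2 (E v).2) = c
  have : cliqueLabel c = .oneFactor ↔ c.val = 2 * n + 2 * n := by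
    unfold cliqueLabel
    split_ifs <;> simp <;> omega
  rw [this]

end

/-! ### Counting the factors and assembling the decomposition. -/

/-- The indices of the `C_{2x}`-factors. -/
abbrev FactorIndex (n : ℕ) : Type :=
  Fin (2 * n) ⊕ (Fin 2 × Fin n) ⊕ (Fin 2 × Fin (n - 1)) ⊕ Fin 3

/-- The label of the factor with a given index. -/
def indexLabel {n : ℕ} : Option (Option (FactorIndex n)) → FactorLabel
  | none => .oneFactor
  | some none => .hexagon
  | some (some (.inl i)) => .clique i
  | some (some (.inr (.inl (c, i)))) => .mixed (c.castAdd 2) i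
  | some (some (.inr (.inr (.inl (c, i))))) => .mixed (c.natAdd 2) (i + 1)
  | some (some (.inr (.inr (.inr t)))) => .special t

theorem indexLabel_injective {n : ℕ} : Injective (indexLabel (n := n)) := by
  rintro (_ | _ | i | ⟨c, i⟩ | ⟨c, i⟩ | t) (_ | _ | j | ⟨c', j⟩ | ⟨c', j⟩ | t') h <;>
    simp [indexLabel, Fin.ext_iff] at h ⊢ <;> omega

theorem exists_indexLabel {n : ℕ} (hn : 2 ≤ n) (T : ZMod (2 * n + 1) → Bool)
    (E : ZMod 6 × ZMod (2 * n + 1) ≃ Fin 3 × Option (ZMod (4 * n + 1)))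
    (u v : ZMod 6 × ZMod (2 * n + 1)) : ∃ i, factorLabel T E u v = indexLabel (n := n) i := by
  unfold factorLabel
  rcases matchingOf u.1 v.1 with _ | c
  · simp only [cliqueLabel]
    generalize cliqueColour (E u).2 (E v).2 = c
    have hc := ZMod.val_lt c
    split_ifs
    · exact ⟨none, rfl⟩
    · exact ⟨some (some (.inl ⟨c.val / 2, by omega⟩)), rfl⟩
  · simp only [matchingLabel]
    generalize edgeDiff c u v = d
    have hd := ZMod.val_lt d
    split_ifs with h1 h2 h2 h3
    · exact ⟨some none, rfl⟩
    · exact ⟨some (some (.inr (.inl (⟨c.val, h1⟩, ⟨(d.val - 1) / 2, by omega⟩)))), rfl⟩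
    · exact ⟨some (some (.inr (.inr (.inr ⟨d.val, h2⟩)))), rfl⟩
    · exact ⟨some (some (.inr (.inr (.inr ⟨(d.val + 2) % 3, by omega⟩)))), rfl⟩
    · have hc : 2 ≤ c.val := not_lt.1 h1
      refine ⟨some (some (.inr (.inr (.inl (⟨c.val - 2, by omega⟩,
        ⟨(d.val - 1) / 2 - 1, by omega⟩))))), ?_⟩
      simp only [indexLabel, FactorLabel.mixed.injEq, Fin.ext_iff, Fin.val_natAdd]
      omega

theorem hwpHasSolution_two_mul_add_one {n r : ℕ} (hn : 2 ≤ n) (hrn : r ≤ 2 * n + 1)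
    (hr : 2 * r ≡ 2 * n + 1 [MOD 3]) :
    HWPHasSolution (6 * (2 * n + 1)) 6 (2 * (2 * n + 1)) 1 (3 * (2 * n + 1) - 2) := by
  obtain ⟨E, hE⟩ := exists_pointEquiv n
  obtain ⟨S, -, hS⟩ := Finset.exists_subset_card_eq
    (s := (Finset.univ : Finset (ZMod (2 * n + 1)))) (n := r)
    (by rwa [Finset.card_univ, ZMod.card])
  let T : ZMod (2 * n + 1) → Bool := fun a => decide (a ∈ S)
  have hT : (Finset.univ.filter fun a => T a = true).card = r := by simpa [T] using hS
  have hx := ZMod.natCast_self (2 * n + 1)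
  push_cast at hx
  refine hwpHasSolution_of_labelling (V := ZMod 6 × ZMod (2 * n + 1)) (J := FactorIndex n)
    ?_ ⟨3 * (2 * n + 1), by ring⟩ ?_ (by omega) (by omega) (factorLabel T E) factorLabel_comm
    indexLabel indexLabel_injective (fun u v _ => exists_indexLabel hn T E u v)
    ⟨_, fun u v => oneFactor_iff hE⟩
    ((isAlternating_hexagon _).congr fun u v => hexagon_iff) ?_
  · rw [Fintype.card_prod, ZMod.card, ZMod.card]
  -- The count is 2n + 2n + 2(n - 1) + 3 = 6n + 1 = 3x - 2.
  · simp only [FactorIndex, Fintype.card_sum, Fintype.card_prod, Fintype.card_fin]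
    omega
  · rintro (i | ⟨c, i⟩ | ⟨c, i⟩ | t)
    · exact ((isAlternating_clique (i : ZMod (4 * n + 1))).lift E).congr fun u v =>
        clique_iff hE i.2
    · exact (isAlternating_shift _ _).congr fun u v => mixed_iff i.2 (Or.inl c.2)
    · exact (isAlternating_shift _ _).congr fun u v =>
        mixed_iff (by have := i.2; omega) (Or.inr (Nat.succ_pos _))
    -- The differences of the two shifts are -1, -1 and 2; the inverse of 2 is -n, since 2n + 1 = 0.
    · obtain ⟨w, hw⟩ : ∃ w, (((t : ℕ) : ZMod (2 * n + 1)) - ((t.val + 1) % 3 : ℕ)) * w = 1 := by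
        fin_cases t
        · exact ⟨-1, by simp⟩
        · exact ⟨-1, by norm_num⟩
        · exact ⟨-n, by simp; linear_combination -hx⟩
      exact (isAlternating_mixedShift hT hr hw).congr fun u v => special_iff hn t.2

theorem mainTheorem3 (x : ℕ) (hx1 : 1 < x) (hx : x ≡ 1 [MOD 6] ∨ x ≡ 5 [MOD 6]) :
    HWPHasSolution (6 * x) 6 (2 * x) 1 (3 * x - 2) := by
  unfold Nat.ModEq at hx
  obtain ⟨n, rfl⟩ : ∃ n, x = 2 * n + 1 := ⟨x / 2, by omega⟩
  -- With r ≡ 2x mod 3 one gets 2r ≡ 4x ≡ x; the remainder also keeps r ≤ 2 ≤ x.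
  refine hwpHasSolution_two_mul_add_one (r := 2 * (2 * n + 1) % 3) (by omega) (by omega) ?_
  unfold Nat.ModEq
  omega
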